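/- Let $X$, $Y$, $W$ be Banach spaces over the same scalar field ($\mathbb{R}$ or $\mathbb{C}$). Write $d(E,F)=\inf\{\|u\|\,\|u^{-1}\| : u:E\to F \text{ an isomorphism}\}$ for the Banach–Mazur distance ($\inf\varnothing=\infty$). Let $\mathfrak{M}(W)$ be the class of all finite-dimensional normed spaces $A$ such that for every $\varepsilon>0$ there is a finite-dimensional subspace $B\subseteq W$ with $d(A,B)<1+\varepsilon$. Suppose that $Y$ has the finite projection property with respect to $W$, that is, there exist a sequence $(A_i)_{i\in\mathbb{N}}$ in $\mathfrak{M}(W)$ that is dense (for every $B\in\mathfrak{M}(W)$ and $\varepsilon>0$ there is $i$ with $d(A_i,B)<1+\varepsilon$), a constant $C<\infty$, and for every $i$ a bounded projection $P_i:Y\to Y$ such that $P_iY$ is isomorphic to $A_i$ and $\|P_i\|\,d(P_iY,A_i)\le C$. Suppose also that $X$ is crudely finitely representable in $W$, that is, $X$ is isomorphic to a Banach space $Z$ such that for every $\varepsilon>0$ and every finite-dimensional subspace $A\subseteq Z$ there are a subspace $B\subseteq W$ and an isomorphism $u:A\to B$ with $\|u\|\,\|u^{-1}\|<1+\varepsilon$.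 Then there exist a set $I$ and an ultrafilter $D$ on $I$ such that the ultrapower $(Y)_D=\ell_\infty(I,Y)/\{(y_i)_{i\in I} : \lim_D\|y_i\|=0\}$ contains a complemented subspace (the range of a bounded projection of $(Y)_D$) that is isomorphic to the bidual $X^{**}$. -/

import Mathlib

open Filter Topology
open scoped ENNReal NNReal

universe k u v w

noncomputable section

/-- The families of an `ℓ_∞`-product that tend to `0` in norm along the ultrafilter `D`. -/
def ultraNull (𝕜 : Type k) [RCLike 𝕜] {I : Type u} (X : I → Type v)
    [∀ i, NormedAddCommGroup (X i)] [∀ i, NormedSpace 𝕜 (X i)] (D : Ultrafilter I) :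
    Submodule 𝕜 (lp X ∞) where
  carrier := {x | Tendsto (fun i => ‖x i‖) (D : Filter I) (𝓝 0)}
  zero_mem' := by simp
  add_mem' := by
    intro x y hx hy
    simp only [Set.mem_ofPred_eq] at hx hy ⊢
    refine squeeze_zero (fun i => norm_nonneg _) (fun i => ?_) (by simpa using hx.add hy)
    exact norm_add_le (x i) (y i)
  smul_mem' := by
    intro c x hx
    simp only [Set.mem_ofPred_eq] at hx ⊢
    have h := hx.const_mul ‖c‖
    simpa [norm_smul] using h

instance ultraNull_isClosed (𝕜 : Type k) [RCLike 𝕜] {I : Type u} (X : I → Type v)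
    [∀ i, NormedAddCommGroup (X i)] [∀ i, NormedSpace 𝕜 (X i)] (D : Ultrafilter I) :
    IsClosed (ultraNull 𝕜 X D : Set (lp X ∞)) := by
  refine isClosed_of_closure_subset fun x hx => ?_
  change Tendsto (fun i => ‖x i‖) (D : Filter I) (𝓝 0)
  rw [Metric.tendsto_nhds]
  intro ε hε
  obtain ⟨y, hy, hxy⟩ := Metric.mem_closure_iff.1 hx (ε / 2) (half_pos hε)
  have hy' : Tendsto (fun i => ‖y i‖) (D : Filter I) (𝓝 0) := hy
  filter_upwards [(Metric.tendsto_nhds.1 hy') (ε / 2) (half_pos hε)] with i hi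
  have h1 : ‖x i - y i‖ ≤ ‖x - y‖ := lp.norm_apply_le_norm ENNReal.top_ne_zero (x - y) i
  have h2 : ‖x i‖ ≤ ‖x i - y i‖ + ‖y i‖ := by
    simpa using norm_add_le (x i - y i) (y i)
  rw [dist_eq_norm] at hxy
  simp only [dist_zero_right, norm_norm] at hi ⊢
  linarith

/-- The ultraproduct `(X_i)_D`: bounded families modulo those tending to `0` along `D`,
with the quotient norm. -/
abbrev Ultraproduct (𝕜 : Type k) [RCLike 𝕜] {I : Type u} (X : I → Type v)
    [∀ i, NormedAddCommGroup (X i)] [∀ i, NormedSpace 𝕜 (X i)] (D : Ultrafilter I) :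
    Type (max u v) :=
  lp X ∞ ⧸ ultraNull 𝕜 X D

/-- The ultrapower `(Y)_D`. -/
abbrev Ultrapower (𝕜 : Type k) [RCLike 𝕜] {I : Type u} (Y : Type v)
    [NormedAddCommGroup Y] [NormedSpace 𝕜 Y] (D : Ultrafilter I) : Type (max u v) :=
  Ultraproduct 𝕜 (fun _ : I => Y) D

/-- The Banach–Mazur distance `inf ‖u‖ ‖u⁻¹‖` over all isomorphisms `u : X → Y`;
it is `∞` if there are none. -/
def banachMazurDist (𝕜 : Type k) [RCLike 𝕜] (X : Type u) (Y : Type v)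
    [NormedAddCommGroup X] [NormedSpace 𝕜 X] [NormedAddCommGroup Y] [NormedSpace 𝕜 Y] : ℝ≥0∞ :=
  ⨅ e : X ≃L[𝕜] Y, ‖(e : X →L[𝕜] Y)‖ₑ * ‖(e.symm : Y →L[𝕜] X)‖ₑ

/-- `Y` is finitely representable in `X`. -/
def FinitelyRepresentable (𝕜 : Type k) [RCLike 𝕜] (Y : Type u) (X : Type v)
    [NormedAddCommGroup Y] [NormedSpace 𝕜 Y] [NormedAddCommGroup X] [NormedSpace 𝕜 X] : Prop :=
  ∀ ε : ℝ, 0 < ε → ∀ A : Submodule 𝕜 Y, FiniteDimensional 𝕜 A →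
    ∃ (B : Submodule 𝕜 X) (e : A ≃L[𝕜] B),
      ‖(e : A →L[𝕜] B)‖ * ‖(e.symm : B →L[𝕜] A)‖ < 1 + ε

/-- `Y` is crudely finitely representable in `X`: it is isomorphic to a Banach space that is
finitely representable in `X`. -/
def CrudelyFinitelyRepresentable (𝕜 : Type k) [RCLike 𝕜] (Y : Type u) (X : Type v)
    [NormedAddCommGroup Y] [NormedSpace 𝕜 Y] [NormedAddCommGroup X] [NormedSpace 𝕜 X] : Prop :=
  ∃ (Z : Type u) (_ : NormedAddCommGroup Z) (_ : NormedSpace 𝕜 Z) (_ : CompleteSpace Z),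
    Nonempty (Y ≃L[𝕜] Z) ∧ FinitelyRepresentable 𝕜 Z X

/-- Finite-dimensional normed spaces over `𝕜`: representatives of the points of the
Minkowski space. -/
structure FinDimSpace (𝕜 : Type k) [RCLike 𝕜] where
  /-- The underlying type. -/
  carrier : Type k
  [normedAddCommGroup : NormedAddCommGroup carrier]
  [normedSpace : NormedSpace 𝕜 carrier]
  [finiteDimensional : FiniteDimensional 𝕜 carrier]

attribute [instance] FinDimSpace.normedAddCommGroup FinDimSpace.normedSpace
  FinDimSpace.finiteDimensional

/-- The Minkowski base of the class of spaces finitely equivalent to `W`: the closure, for the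
Banach–Mazur distance, of the finite-dimensional subspaces of `W`. -/
def minkowskiBase (𝕜 : Type k) [RCLike 𝕜] (W : Type w)
    [NormedAddCommGroup W] [NormedSpace 𝕜 W] : Set (FinDimSpace 𝕜) :=
  {A | ∀ ε : ℝ≥0, 0 < ε → ∃ B : Submodule 𝕜 W, FiniteDimensional 𝕜 B ∧
    banachMazurDist 𝕜 A.carrier B < 1 + ε}

/-- `Z` has the finite projection property with respect to (the class of finite equivalence of)
`W`. The condition `≠ ∞` is needed since `0 * ∞ = 0` in `ℝ≥0∞`. -/
def FiniteProjectionProperty (𝕜 : Type k) [RCLike 𝕜] (Z : Type v) (W : Type w)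
    [NormedAddCommGroup Z] [NormedSpace 𝕜 Z] [NormedAddCommGroup W] [NormedSpace 𝕜 W] : Prop :=
  ∃ A : ℕ → FinDimSpace 𝕜,
    (∀ i, A i ∈ minkowskiBase 𝕜 W) ∧
    (∀ B ∈ minkowskiBase 𝕜 W, ∀ ε : ℝ≥0, 0 < ε →
      ∃ i, banachMazurDist 𝕜 (A i).carrier B.carrier < 1 + ε) ∧
    ∃ C : ℝ≥0, ∀ i, ∃ P : Z →L[𝕜] Z, IsIdempotentElem P ∧
      banachMazurDist 𝕜 (LinearMap.range (P : Z →ₗ[𝕜] Z)) (A i).carrier ≠ ∞ ∧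
      ‖P‖ₑ * banachMazurDist 𝕜 (LinearMap.range (P : Z →ₗ[𝕜] Z)) (A i).carrier ≤ C

end

/-! Write `Z` for the space isomorphic to `X` and finitely representable in `W`. Every
finite-dimensional `F ⊆ Z**` embeds in `Z` with distortion at most 12, a crude form of local
reflexivity (`exists_embedding_of_bidual`). Its image is 2-close to a subspace of `W`, which is
2-close to some `A_i`, which is complemented in `Y` with constant controlled by `C`. So `id_F = q_F
∘ v_F` through `Y` with `‖v_F‖ ≤ 1` and `‖q_F‖ ≤ K`, where `K` does not depend on `F`.

An ultrafilter on the finite subsets of `Z**`, finer than the order filter, glues the `v_F` of their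
spans into `J : Z** → (Y)_D`. Since `Z**` is a dual space, the `q_F` have a weak-star limit `Q :
(Y)_D → Z**`, and `Q ∘ J = id` because `q_F (v_F z) = z` as soon as `z ∈ F`. Then `J ∘ Q` is a
projection onto a copy of `Z**`, and `Z**` is isomorphic to `X**`. -/

section

set_option maxSynthPendingDepth 3

/-! ### Crude local reflexivity -/

/-- The dual of a finite `ℓ_∞`-sum is the `ℓ_1`-sum of the duals. -/
theorem sum_norm_comp_single_le {𝕜 : Type*} [RCLike 𝕜] {ι : Type*} [Fintype ι] [DecidableEq ι]
    {Z : Type*} [NormedAddCommGroup Z] [NormedSpace 𝕜 Z] (θ : StrongDual 𝕜 (ι → Z)) :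
    ∑ j, ‖θ.comp (ContinuousLinearMap.single 𝕜 (fun _ : ι => Z) j)‖ ≤ ‖θ‖ := by
  set h : ι → StrongDual 𝕜 Z := fun j => θ.comp (ContinuousLinearMap.single 𝕜 (fun _ : ι => Z) j)
  have key : ∀ ε : ℝ, 0 < ε → ∑ j, (‖h j‖ - ε) ≤ ‖θ‖ := by
    intro ε hε
    have hx : ∀ j, ∃ x : Z, ‖x‖ ≤ 1 ∧ ‖h j‖ - ε ≤ ‖h j x‖ := by
      intro j
      obtain ⟨x, hx1, hx2⟩ := (h j).exists_lt_apply_of_lt_opNorm (sub_lt_self ‖h j‖ hε)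
      exact ⟨x, hx1.le, hx2.le⟩
    choose x hx1 hx2 using hx
    -- Unimodular factors rotate the values so that they add up without cancellation.
    choose c hc1 hc2 using fun j => RCLike.exists_norm_eq_mul_self (h j (x j))
    have hsum : θ (fun j => c j • x j) = ((∑ j, ‖h j (x j)‖ : ℝ) : 𝕜) := by
      have : (fun j => c j • x j) = ∑ j, Pi.single j (c j • x j) :=
        (Finset.univ_sum_single _).symm
      rw [this, map_sum]
      push_cast
      refine Finset.sum_congr rfl fun j _ => ?_
      refine Eq.trans ?_ (hc2 j).symm
      rw [← smul_eq_mul, ← map_smul]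
      rfl
    have hnorm : ‖θ (fun j => c j • x j)‖ ≤ ‖θ‖ := by
      refine θ.le_of_opNorm_le_of_le le_rfl ?_ |>.trans_eq (mul_one _)
      refine (pi_norm_le_iff_of_nonneg zero_le_one).2 fun j => ?_
      rw [norm_smul, hc1, one_mul]
      exact hx1 j
    rw [hsum, RCLike.norm_ofReal, abs_of_nonneg (Finset.sum_nonneg fun _ _ => norm_nonneg _)]
      at hnorm
    exact (Finset.sum_le_sum fun j _ => hx2 j).trans hnorm
  have hlim : Tendsto (fun ε : ℝ => ∑ j, (‖h j‖ - ε)) (𝓝[>] 0) (𝓝 (∑ j, ‖h j‖)) := by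
    have : Continuous fun ε : ℝ => ∑ j, (‖h j‖ - ε) := by fun_prop
    simpa using (this.tendsto 0).mono_left nhdsWithin_le_nhds
  exact le_of_tendsto hlim (eventually_nhdsWithin_of_forall key)

/-- Helly's condition: functionals on `ι → Z` bounded by `s` on the values of the operators
`F → Z` pair with the tuple `z` as with elements of the bidual. -/
theorem norm_sum_bidual_le {𝕜 : Type*} [RCLike 𝕜] {ι : Type*} [Fintype ι]
    {Z : Type*} [NormedAddCommGroup Z] [NormedSpace 𝕜 Z]
    (F : Submodule 𝕜 (StrongDual 𝕜 (StrongDual 𝕜 Z))) [FiniteDimensional 𝕜 F]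
    (z : ι → F) (hz : ∀ j, ‖z j‖ ≤ 1) (g : ι → StrongDual 𝕜 Z) {s : ℝ} (hs : 0 ≤ s)
    (h : ∀ T : F →L[𝕜] Z, ‖∑ j, g j (T (z j))‖ ≤ s * ‖fun j => T (z j)‖) :
    ‖∑ j, (z j : StrongDual 𝕜 (StrongDual 𝕜 Z)) (g j)‖ ≤ s := by
  classical
  let E : (F →L[𝕜] Z) →ₗ[𝕜] (ι → Z) :=
    { toFun := fun T j => T (z j), map_add' := fun _ _ => rfl, map_smul' := fun _ _ => rfl }
  let G : (ι → Z) →ₗ[𝕜] 𝕜 := ∑ j, (g j : Z →ₗ[𝕜] 𝕜) ∘ₗ LinearMap.proj j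
  have hG : ∀ y, G y = ∑ j, g j (y j) := fun y => by simp [G]
  let θ₀ : StrongDual 𝕜 (LinearMap.range E) :=
    (G.domRestrict (LinearMap.range E)).mkContinuous s (by
      rintro ⟨_, T, rfl⟩
      exact (congrArg norm (hG (E T))).trans_le (h T))
  have hθ₀ : ‖θ₀‖ ≤ s := LinearMap.mkContinuous_norm_le _ hs _
  -- The Hahn–Banach extension `θ` has components `f j` of total norm at most `s`. They agree with
  -- `g` only on tuples `T (z j)`, but this suffices to replace `g` by `f` in the pairing with `z`.
  obtain ⟨θ, hθ, hθn⟩ := exists_extension_norm_eq (LinearMap.range E) θ₀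
  let f : ι → StrongDual 𝕜 Z := fun j => θ.comp (ContinuousLinearMap.single 𝕜 (fun _ : ι => Z) j)
  have hf : ∀ y, θ y = ∑ j, f j (y j) := by
    intro y
    conv_lhs => rw [← Finset.univ_sum_single y, map_sum]
    rfl
  have hfg : ∀ T : F →L[𝕜] Z, ∑ j, (g j - f j) (T (z j)) = 0 := by
    intro T
    have h1 : θ (E T) = G (E T) := hθ ⟨E T, T, rfl⟩
    rw [hf, hG] at h1
    simp only [_root_.sub_apply, Finset.sum_sub_distrib]
    exact sub_eq_zero.2 h1.symm
  let b := Module.finBasis 𝕜 F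
  have hb : ∀ l, ∑ j, b.repr (z j) l • (g j - f j) = 0 := by
    intro l
    ext x
    -- Rank-one operators `b.coord l ⊗ x` extract the coefficient of each basis vector.
    have h1 := hfg (((b.coord l).toContinuousLinearMap).smulRight x)
    simpa [mul_comm] using h1
  have hzero : ∑ j, (z j : StrongDual 𝕜 (StrongDual 𝕜 Z)) (g j - f j) = 0 := by
    have h1 : ∀ j, (z j : StrongDual 𝕜 (StrongDual 𝕜 Z)) (g j - f j)
        = ∑ l, (b l : StrongDual 𝕜 (StrongDual 𝕜 Z)) (b.repr (z j) l • (g j - f j)) := by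
      intro j
      have h2 := congrArg (fun x : F => (x : StrongDual 𝕜 (StrongDual 𝕜 Z)) (g j - f j))
        (b.sum_repr (z j))
      simp only [Submodule.coe_sum, Submodule.coe_smul, _root_.sum_apply, _root_.smul_apply] at h2
      simp only [map_smul]
      exact h2.symm
    simp only [h1]
    rw [Finset.sum_comm]
    refine Finset.sum_eq_zero fun l _ => ?_
    rw [← map_sum, hb, map_zero]
  have heq : ∑ j, (z j : StrongDual 𝕜 (StrongDual 𝕜 Z)) (g j)
      = ∑ j, (z j : StrongDual 𝕜 (StrongDual 𝕜 Z)) (f j) := by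
    rw [← sub_eq_zero, ← Finset.sum_sub_distrib]
    simpa using hzero
  rw [heq]
  calc _ ≤ ∑ j, ‖(z j : StrongDual 𝕜 (StrongDual 𝕜 Z)) (f j)‖ := norm_sum_le _ _
    _ ≤ ∑ j, ‖f j‖ := Finset.sum_le_sum fun j _ =>
        ((z j : StrongDual 𝕜 (StrongDual 𝕜 Z)).le_of_opNorm_le (hz j) _).trans_eq (one_mul _)
    _ ≤ ‖θ‖ := sum_norm_comp_single_le θ
    _ ≤ s := hθn.trans_le hθ₀

/-- Approximate lifting from the bidual, at finitely many points and functionals. -/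
theorem exists_approx_lift {𝕜 : Type*} [RCLike 𝕜] {ι : Type*} [Fintype ι]
    {Z : Type*} [NormedAddCommGroup Z] [NormedSpace 𝕜 Z]
    (F : Submodule 𝕜 (StrongDual 𝕜 (StrongDual 𝕜 Z))) [FiniteDimensional 𝕜 F]
    (z : ι → F) (hz : ∀ j, ‖z j‖ ≤ 1) (g : ι → StrongDual 𝕜 Z) {η : ℝ} (hη : 0 < η) :
    ∃ T : F →L[𝕜] Z, (∀ j, ‖T (z j)‖ ≤ 1) ∧
      ∀ j, ‖g j (T (z j)) - (z j : StrongDual 𝕜 (StrongDual 𝕜 Z)) (g j)‖ < η := by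
  classical
  let Φ : (F →L[𝕜] Z) → (ι → 𝕜) := fun T j => g j (T (z j))
  let S : Set (ι → 𝕜) := Φ '' {T | ∀ j, ‖T (z j)‖ ≤ 1}
  let c : ι → 𝕜 := fun j => (z j : StrongDual 𝕜 (StrongDual 𝕜 Z)) (g j)
  suffices hc : c ∈ closure S by
    obtain ⟨_, ⟨T, hT, rfl⟩, hd⟩ := Metric.mem_closure_iff.1 hc η hη
    refine ⟨T, hT, fun j => ?_⟩
    rw [dist_comm, dist_eq_norm] at hd
    exact (norm_le_pi_norm (Φ T - c) j).trans_lt hd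
  by_contra hc
  have hconv : Convex ℝ S := by
    rintro _ ⟨T, hT, rfl⟩ _ ⟨T', hT', rfl⟩ a b ha hb hab
    refine ⟨(a : 𝕜) • T + (b : 𝕜) • T', fun j => ?_, ?_⟩
    · calc ‖((a : 𝕜) • T + (b : 𝕜) • T') (z j)‖ ≤ ‖(a : 𝕜) • T (z j)‖ + ‖(b : 𝕜) • T' (z j)‖ :=
            norm_add_le _ _
        _ = a * ‖T (z j)‖ + b * ‖T' (z j)‖ := by
            rw [norm_smul, norm_smul, RCLike.norm_of_nonneg ha, RCLike.norm_of_nonneg hb]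
        _ ≤ a * 1 + b * 1 := by gcongr; exacts [hT j, hT' j]
        _ = 1 := by linarith
    · ext j
      simp [Φ, RCLike.real_smul_eq_coe_mul]
  -- If `c` is not in the closure, a functional separates it from `S`. As `S` is balanced, the bound
  -- on real parts becomes one on absolute values, and Helly's condition contradicts the separation.
  obtain ⟨f, s, hfS, hfc⟩ := RCLike.geometric_hahn_banach_closed_point (𝕜 := 𝕜)
    hconv.closure isClosed_closure hc
  have hs : 0 < s := by
    have := hfS 0 (subset_closure ⟨0, by simp, by ext; simp [Φ]⟩)
    simpa using this
  have hball : ∀ T : F →L[𝕜] Z, (∀ j, ‖T (z j)‖ ≤ 1) → ‖f (Φ T)‖ ≤ s := by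
    intro T hT
    obtain ⟨a, ha, hfa⟩ := RCLike.exists_norm_eq_mul_self (f (Φ T))
    have h1 : f (Φ (a • T)) = (‖f (Φ T)‖ : 𝕜) := by
      have : Φ (a • T) = a • Φ T := by ext j; simp [Φ]
      rw [this, map_smul, hfa, smul_eq_mul]
    have h2 := hfS (Φ (a • T)) (subset_closure ⟨a • T, fun j => by
      simpa [norm_smul, ha] using hT j, rfl⟩)
    rw [h1, RCLike.ofReal_re] at h2
    exact h2.le
  let α : ι → 𝕜 := fun j => f (Pi.single j 1)
  have hf : ∀ y, f y = ∑ j, (α j) * y j := by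
    intro y
    conv_lhs => rw [← Finset.univ_sum_single y, map_sum]
    refine Finset.sum_congr rfl fun j _ => ?_
    have : (Pi.single j (y j) : ι → 𝕜) = y j • Pi.single j 1 := by
      rw [← Pi.single_smul, smul_eq_mul, mul_one]
    rw [this, map_smul, smul_eq_mul, mul_comm]
  have hbound := norm_sum_bidual_le F z hz (fun j => α j • g j) hs.le (by
    intro T
    have hfT : ∑ j, (α j • g j) (T (z j)) = f (Φ T) := by simp [hf, Φ]
    rw [hfT]
    rcases eq_or_ne (fun j => T (z j)) 0 with h0 | h0
    · have : Φ T = 0 := by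
        ext j
        have : T (z j) = 0 := congrFun h0 j
        simp [Φ, this]
      simp [this, h0]
    · have hpos : 0 < ‖fun j => T (z j)‖ := norm_pos_iff.2 h0
      have h1 := hball (((‖fun j => T (z j)‖⁻¹ : ℝ) : 𝕜) • T) (fun j => by
        rw [_root_.smul_apply, norm_smul, RCLike.norm_of_nonneg (by positivity)]
        rw [inv_mul_le_iff₀ hpos, mul_one]
        exact norm_le_pi_norm (fun j => T (z j)) j)
      have h2 : Φ (((‖fun j => T (z j)‖⁻¹ : ℝ) : 𝕜) • T)
          = ((‖fun j => T (z j)‖⁻¹ : ℝ) : 𝕜) • Φ T := by ext j; simp [Φ]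
      rw [h2, map_smul, norm_smul, RCLike.norm_of_nonneg (by positivity),
        inv_mul_le_iff₀ hpos] at h1
      linarith)
  have hfc' : f c = ∑ j, (z j : StrongDual 𝕜 (StrongDual 𝕜 Z)) (α j • g j) := by
    simp [hf, c]
  rw [← hfc'] at hbound
  exact absurd ((RCLike.re_le_norm (f c)).trans hbound) (not_le.2 hfc)

/-- Finite-dimensional subspaces of the bidual of `Z` embed in `Z` with uniform distortion. -/
theorem exists_embedding_of_bidual {𝕜 : Type*} [RCLike 𝕜]
    {Z : Type*} [NormedAddCommGroup Z] [NormedSpace 𝕜 Z]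
    (F : Submodule 𝕜 (StrongDual 𝕜 (StrongDual 𝕜 Z))) [FiniteDimensional 𝕜 F] :
    ∃ T : F →L[𝕜] Z, ‖T‖ ≤ 2 ∧ ∀ x, ‖x‖ ≤ 6 * ‖T x‖ := by
  have : ProperSpace F := FiniteDimensional.proper_rclike 𝕜 F
  -- On a 1/4-net, `T` loses at most 1/8 + 1/8 of the norm: one 1/8 from nearly norming functionals,
  -- one from the approximate lift.
  obtain ⟨t, hts, htf, htc⟩ := (isCompact_closedBall (0 : F) 1).finite_cover_balls
    (e := 1 / 4) (by norm_num)
  have := htf.fintype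
  have hz : ∀ j : t, ‖(j : F)‖ ≤ 1 := fun j => by simpa using hts j.2
  have hg : ∀ j : t, ∃ g : StrongDual 𝕜 Z, ‖g‖ ≤ 1 ∧
      ‖(j : F)‖ - 1 / 8 ≤ ‖((j : F) : StrongDual 𝕜 (StrongDual 𝕜 Z)) g‖ := by
    intro j
    obtain ⟨g, h1, h2⟩ := ((j : F) : StrongDual 𝕜 (StrongDual 𝕜 Z)).exists_lt_apply_of_lt_opNorm
      (r := ‖(j : F)‖ - 1 / 8) (sub_lt_self _ (by norm_num))
    exact ⟨g, h1.le, h2.le⟩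
  choose g hg1 hg2 using hg
  obtain ⟨T, hT1, hT2⟩ := exists_approx_lift F (fun j : t => (j : F)) hz g
    (η := 1 / 8) (by norm_num)
  have hlow : ∀ j : t, ‖(j : F)‖ - 1 / 4 ≤ ‖T j‖ := by
    intro j
    have h1 : ‖g j (T j)‖ ≤ ‖T j‖ :=
      ((g j).le_of_opNorm_le (hg1 j) _).trans_eq (one_mul _)
    have h2 := norm_sub_norm_le (((j : F) : StrongDual 𝕜 (StrongDual 𝕜 Z)) (g j)) (g j (T j))
    rw [norm_sub_rev] at h2
    linarith [hT2 j, hg2 j]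
  have hnet : ∀ x : F, ‖x‖ ≤ 1 → ∃ j : t, ‖x - j‖ ≤ 1 / 4 := by
    intro x hx
    have := htc (show x ∈ Metric.closedBall 0 1 by simpa using hx)
    simp only [Set.mem_iUnion, Metric.mem_ball, dist_eq_norm] at this
    obtain ⟨j, hj, h⟩ := this
    exact ⟨⟨j, hj⟩, h.le⟩
  have hball : ∀ x : F, ‖x‖ = 1 → ‖T x‖ ≤ 1 + ‖T‖ * (1 / 4) := by
    intro x hx
    obtain ⟨j, hj⟩ := hnet x hx.le
    have h1 : T x = T j + T (x - j) := by simp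
    have h2 := T.le_of_opNorm_le_of_le le_rfl hj
    rw [h1]
    exact (norm_add_le _ _).trans (add_le_add (hT1 j) h2)
  -- The net bound is absorbed: `‖T‖ ≤ 1 + ‖T‖ / 4`.
  have hT : ‖T‖ ≤ 4 / 3 := by
    have h1 : ‖T‖ ≤ 1 + ‖T‖ * (1 / 4) :=
      T.opNorm_le_of_unit_norm (𝕜 := 𝕜) (by positivity) hball
    linarith
  refine ⟨T, by linarith, fun x => ?_⟩
  rcases eq_or_ne x 0 with rfl | hx
  · simp
  have hpos : 0 < ‖x‖ := norm_pos_iff.2 hx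
  have hunit : ‖((‖x‖⁻¹ : ℝ) : 𝕜) • x‖ = 1 := by
    rw [norm_smul, RCLike.norm_of_nonneg (by positivity), inv_mul_cancel₀ hpos.ne']
  obtain ⟨j, hj⟩ := hnet _ hunit.le
  have h1 : ‖T (((‖x‖⁻¹ : ℝ) : 𝕜) • x - j)‖ ≤ 4 / 3 * (1 / 4) := T.le_of_opNorm_le_of_le hT hj
  have h2 : ‖T j‖ - ‖T (((‖x‖⁻¹ : ℝ) : 𝕜) • x)‖ ≤ ‖T (((‖x‖⁻¹ : ℝ) : 𝕜) • x - j)‖ := by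
    rw [map_sub, norm_sub_rev]
    exact norm_sub_norm_le _ _
  have h3 := norm_sub_norm_le (((‖x‖⁻¹ : ℝ) : 𝕜) • x) (j : F)
  -- The net point has norm at least 3/4, so its image has norm at least 1/2; the error is at most
  -- 4/3 · 1/4 = 1/3.
  have h4 : 1 / 6 ≤ ‖T (((‖x‖⁻¹ : ℝ) : 𝕜) • x)‖ := by linarith [hlow j]
  rw [map_smul, norm_smul, RCLike.norm_of_nonneg (by positivity), le_inv_mul_iff₀ hpos] at h4
  linarith

/-! ### Uniform factorizations through `Y` -/

/-- The identity of `F` factors through `Y` with constant `K`; equivalently, `F` is isomorphic to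
a complemented subspace of `Y`, with control of the constants. -/
def IdFactorsThrough (𝕜 : Type*) [RCLike 𝕜] (F Y : Type*) [NormedAddCommGroup F]
    [NormedSpace 𝕜 F] [NormedAddCommGroup Y] [NormedSpace 𝕜 Y] (K : ℝ) : Prop :=
  ∃ (v : F →L[𝕜] Y) (q : Y →L[𝕜] F), (∀ x, q (v x) = x) ∧ ‖v‖ * ‖q‖ ≤ K

theorem IdFactorsThrough.of_equiv {𝕜 : Type*} [RCLike 𝕜] {F G Y : Type*} [NormedAddCommGroup F]
    [NormedSpace 𝕜 F] [NormedAddCommGroup G] [NormedSpace 𝕜 G] [NormedAddCommGroup Y]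
    [NormedSpace 𝕜 Y] {K c : ℝ} (h : IdFactorsThrough 𝕜 G Y K) (e : F ≃L[𝕜] G)
    (he : ‖(e : F →L[𝕜] G)‖ * ‖(e.symm : G →L[𝕜] F)‖ ≤ c) : IdFactorsThrough 𝕜 F Y (c * K) := by
  obtain ⟨v, q, hqv, hK⟩ := h
  refine ⟨v.comp (e : F →L[𝕜] G), (e.symm : G →L[𝕜] F).comp q, fun x => by simp [hqv], ?_⟩
  calc _ ≤ (‖v‖ * ‖(e : F →L[𝕜] G)‖) * (‖(e.symm : G →L[𝕜] F)‖ * ‖q‖) := by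
        gcongr <;> exact ContinuousLinearMap.opNorm_comp_le _ _
    _ = (‖(e : F →L[𝕜] G)‖ * ‖(e.symm : G →L[𝕜] F)‖) * (‖v‖ * ‖q‖) := by ring
    _ ≤ c * K := mul_le_mul he hK (by positivity) ((by positivity : (0 : ℝ) ≤ _).trans he)

theorem IdFactorsThrough.exists_normalized {𝕜 : Type*} [RCLike 𝕜] {F Y : Type*}
    [NormedAddCommGroup F] [NormedSpace 𝕜 F] [NormedAddCommGroup Y] [NormedSpace 𝕜 Y] {K : ℝ}
    (h : IdFactorsThrough 𝕜 F Y K) :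
    ∃ (v : F →L[𝕜] Y) (q : Y →L[𝕜] F), (∀ x, q (v x) = x) ∧ ‖v‖ ≤ 1 ∧ ‖q‖ ≤ K := by
  obtain ⟨v, q, hqv, hK⟩ := h
  -- If `v = 0`, then `F` is trivial and rescaling by `‖v‖` is impossible.
  rcases eq_or_ne v 0 with rfl | hv
  · refine ⟨0, 0, fun x => ?_, by simp, by simpa using hK⟩
    simpa using hqv x
  · have hpos : 0 < ‖v‖ := norm_pos_iff.2 hv
    have hpos' : (‖v‖ : 𝕜) ≠ 0 := by exact_mod_cast hpos.ne'
    refine ⟨(‖v‖ : 𝕜)⁻¹ • v, (‖v‖ : 𝕜) • q, fun x => ?_, ?_, ?_⟩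
    · simp [hqv, hpos']
    · rw [norm_smul, norm_inv, RCLike.norm_ofReal, abs_norm, inv_mul_cancel₀ hpos.ne']
    · rwa [norm_smul, RCLike.norm_ofReal, abs_norm]

/-- A finite-dimensional space of any universe is isometric to a point of the Minkowski space. -/
theorem exists_finDimSpace_isometry {𝕜 : Type k} [RCLike 𝕜] (B : Type*) [NormedAddCommGroup B]
    [NormedSpace 𝕜 B] [FiniteDimensional 𝕜 B] :
    ∃ A : FinDimSpace 𝕜, Nonempty (A.carrier ≃ₗᵢ[𝕜] B) := by
  let e : (Fin (Module.finrank 𝕜 B) → 𝕜) ≃ₗ[𝕜] B := (Module.finBasis 𝕜 B).equivFun.symm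
  let i₁ : NormedAddCommGroup (Fin (Module.finrank 𝕜 B) → 𝕜) :=
    NormedAddCommGroup.induced _ B e.toLinearMap e.injective
  let i₂ : @NormedSpace 𝕜 (Fin (Module.finrank 𝕜 B) → 𝕜) _ i₁.toSeminormedAddCommGroup :=
    @NormedSpace.mk _ _ _ i₁.toSeminormedAddCommGroup inferInstance (fun a x => by
      change ‖e (a • x)‖ ≤ ‖a‖ * ‖e x‖
      rw [map_smul, norm_smul])
  exact ⟨@FinDimSpace.mk 𝕜 _ (Fin (Module.finrank 𝕜 B) → 𝕜) i₁ i₂ inferInstance,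
    ⟨@LinearIsometryEquiv.mk _ _ _ _ _ _ _ _ _ _ i₁.toSeminormedAddCommGroup _ _ _ e
      fun _ => rfl⟩⟩

theorem exists_equiv_of_banachMazurDist_lt {𝕜 : Type k} [RCLike 𝕜] {X : Type u} {Y : Type v}
    [NormedAddCommGroup X] [NormedSpace 𝕜 X] [NormedAddCommGroup Y] [NormedSpace 𝕜 Y]
    {r : ℝ≥0} (h : banachMazurDist 𝕜 X Y < r) :
    ∃ e : X ≃L[𝕜] Y, ‖(e : X →L[𝕜] Y)‖ * ‖(e.symm : Y →L[𝕜] X)‖ < r := by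
  obtain ⟨e, he⟩ := iInf_lt_iff.1 h
  refine ⟨e, ?_⟩
  rw [enorm_eq_nnnorm, enorm_eq_nnnorm] at he
  exact_mod_cast he

theorem LinearIsometryEquiv.norm_mul_norm_symm_le {𝕜 : Type*} [RCLike 𝕜] {X Y : Type*}
    [NormedAddCommGroup X] [NormedSpace 𝕜 X] [NormedAddCommGroup Y] [NormedSpace 𝕜 Y]
    (e : X ≃ₗᵢ[𝕜] Y) :
    ‖((e : X ≃L[𝕜] Y) : X →L[𝕜] Y)‖ * ‖((e : X ≃L[𝕜] Y).symm : Y →L[𝕜] X)‖ ≤ 1 :=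
  mul_le_one₀ (e.toLinearIsometry.norm_toContinuousLinearMap_le) (norm_nonneg _)
    (e.symm.toLinearIsometry.norm_toContinuousLinearMap_le)

theorem banachMazurDist_le_one {𝕜 : Type k} [RCLike 𝕜] {X : Type u} {Y : Type v}
    [NormedAddCommGroup X] [NormedSpace 𝕜 X] [NormedAddCommGroup Y] [NormedSpace 𝕜 Y]
    (e : X ≃ₗᵢ[𝕜] Y) : banachMazurDist 𝕜 X Y ≤ 1 := by
  refine iInf_le_of_le (e : X ≃L[𝕜] Y) ?_
  rw [enorm_eq_nnnorm, enorm_eq_nnnorm]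
  exact_mod_cast e.norm_mul_norm_symm_le

/-- A space close to the range of a projection factors through the ambient space. -/
theorem idFactorsThrough_of_projection {𝕜 : Type k} [RCLike 𝕜] {A : Type u} {Y : Type v}
    [NormedAddCommGroup A] [NormedSpace 𝕜 A] [NormedAddCommGroup Y] [NormedSpace 𝕜 Y]
    (P : Y →L[𝕜] Y) (hP : IsIdempotentElem P)
    (hA : banachMazurDist 𝕜 (LinearMap.range (P : Y →ₗ[𝕜] Y)) A ≠ ∞) {C : ℝ≥0}
    (hC : ‖P‖ₑ * banachMazurDist 𝕜 (LinearMap.range (P : Y →ₗ[𝕜] Y)) A ≤ C) :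
    IdFactorsThrough 𝕜 A Y (C + 1) := by
  have : Nonempty ((LinearMap.range (P : Y →ₗ[𝕜] Y)) ≃L[𝕜] A) := by
    by_contra hne
    rw [not_nonempty_iff] at hne
    exact hA (by simp [banachMazurDist])
  -- The infimum need not be attained; the slack 1 yields an actual isomorphism.
  have hlt : ‖P‖ₑ * banachMazurDist 𝕜 (LinearMap.range (P : Y →ₗ[𝕜] Y)) A < ((C + 1 : ℝ≥0) : ℝ≥0∞) :=
    hC.trans_lt (by exact_mod_cast lt_add_one C)
  rw [banachMazurDist, ENNReal.mul_iInf (by simp)] at hlt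
  obtain ⟨e, he⟩ := iInf_lt_iff.1 hlt
  simp only [enorm_eq_nnnorm] at he
  have he' : ‖P‖ * (‖(e : LinearMap.range (P : Y →ₗ[𝕜] Y) →L[𝕜] A)‖ *
      ‖(e.symm : A →L[𝕜] LinearMap.range (P : Y →ₗ[𝕜] Y))‖) < C + 1 := by exact_mod_cast he
  let P' : Y →L[𝕜] LinearMap.range (P : Y →ₗ[𝕜] Y) := P.codRestrict _ fun x => ⟨x, rfl⟩
  have hP'n : ‖P'‖ ≤ ‖P‖ := P'.opNorm_le_bound (norm_nonneg _) fun x => P.le_opNorm x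
  have hP' : ∀ x : LinearMap.range (P : Y →ₗ[𝕜] Y), P' x = x := by
    rintro ⟨_, y, rfl⟩
    exact Subtype.ext (DFunLike.congr_fun hP y)
  refine ⟨(LinearMap.range (P : Y →ₗ[𝕜] Y)).subtypeL.comp
    (e.symm : A →L[𝕜] LinearMap.range (P : Y →ₗ[𝕜] Y)),
    (e : LinearMap.range (P : Y →ₗ[𝕜] Y) →L[𝕜] A).comp P', fun x => by simp [hP'], ?_⟩
  calc _ ≤ (1 * ‖(e.symm : A →L[𝕜] LinearMap.range (P : Y →ₗ[𝕜] Y))‖) *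
        (‖(e : LinearMap.range (P : Y →ₗ[𝕜] Y) →L[𝕜] A)‖ * ‖P‖) := by
        gcongr
        · exact (ContinuousLinearMap.opNorm_comp_le _ _).trans
            (by gcongr; exact Submodule.norm_subtypeL_le _)
        · exact (ContinuousLinearMap.opNorm_comp_le _ _).trans (by gcongr)
    _ = ‖P‖ * (‖(e : LinearMap.range (P : Y →ₗ[𝕜] Y) →L[𝕜] A)‖ *
      ‖(e.symm : A →L[𝕜] LinearMap.range (P : Y →ₗ[𝕜] Y))‖) := by ring
    _ ≤ _ := he'.le

/-- Density passes from the sequence `A i` to all finite-dimensional subspaces of `W` at the cost of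
a factor 2. -/
theorem FiniteProjectionProperty.exists_idFactorsThrough {𝕜 : Type k} [RCLike 𝕜] {Y : Type v}
    [NormedAddCommGroup Y] [NormedSpace 𝕜 Y] {W : Type w} [NormedAddCommGroup W] [NormedSpace 𝕜 W]
    (hY : FiniteProjectionProperty 𝕜 Y W) :
    ∃ K : ℝ, ∀ B : Submodule 𝕜 W, FiniteDimensional 𝕜 B → IdFactorsThrough 𝕜 B Y K := by
  obtain ⟨A, -, hdense, C, hP⟩ := hY
  refine ⟨1 * (2 * (C + 1)), fun B hB => ?_⟩
  obtain ⟨B', ⟨e⟩⟩ := exists_finDimSpace_isometry (𝕜 := 𝕜) B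
  have hB' : B' ∈ minkowskiBase 𝕜 W := fun ε hε =>
    ⟨B, hB, (banachMazurDist_le_one e).trans_lt (by exact_mod_cast lt_add_of_pos_right 1 hε)⟩
  obtain ⟨i, hi⟩ := hdense B' hB' 1 one_pos
  obtain ⟨f, hf⟩ := exists_equiv_of_banachMazurDist_lt (r := 2)
    (hi.trans_eq (by norm_num))
  obtain ⟨P, hPi, hPA, hPC⟩ := hP i
  refine ((idFactorsThrough_of_projection P hPi hPA hPC).of_equiv f.symm ?_).of_equiv
    (e.symm : B ≃L[𝕜] B'.carrier) e.symm.norm_mul_norm_symm_le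
  rw [mul_comm]
  exact hf.le

/-- If `Z` is finitely representable in `W`, then the finite-dimensional subspaces of the bidual
of `Z` are uniformly complemented in any space with the finite projection property with respect
to `W`. -/
theorem FiniteProjectionProperty.exists_bidual_factorization {𝕜 : Type k} [RCLike 𝕜]
    {Y : Type v} [NormedAddCommGroup Y] [NormedSpace 𝕜 Y]
    {W : Type w} [NormedAddCommGroup W] [NormedSpace 𝕜 W]
    {Z : Type u} [NormedAddCommGroup Z] [NormedSpace 𝕜 Z]
    (hY : FiniteProjectionProperty 𝕜 Y W) (hZ : FinitelyRepresentable 𝕜 Z W) :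
    ∃ K : ℝ, ∀ F : Submodule 𝕜 (StrongDual 𝕜 (StrongDual 𝕜 Z)), FiniteDimensional 𝕜 F →
      ∃ (v : F →L[𝕜] Y) (q : Y →L[𝕜] F), (∀ x, q (v x) = x) ∧ ‖v‖ ≤ 1 ∧ ‖q‖ ≤ K := by
  obtain ⟨K, hK⟩ := hY.exists_idFactorsThrough
  -- `2 * 6` is the distortion of the embedding into `Z`; the other 2 comes from finite
  -- representability with `ε = 1`.
  refine ⟨2 * 6 * (2 * K), fun F hF => IdFactorsThrough.exists_normalized ?_⟩
  obtain ⟨T, hT, hT'⟩ := exists_embedding_of_bidual F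
  have hinj : Function.Injective (T : F →ₗ[𝕜] Z) := by
    refine (injective_iff_map_eq_zero _).2 fun x hx => ?_
    have h1 := hT' x
    rw [show T x = 0 from hx, norm_zero, mul_zero] at h1
    exact norm_le_zero_iff.1 h1
  let e := (LinearEquiv.ofInjective (T : F →ₗ[𝕜] Z) hinj).toContinuousLinearEquiv
  have he : ∀ x, ((e x : LinearMap.range (T : F →ₗ[𝕜] Z)) : Z) = T x := fun x => rfl
  obtain ⟨B, f, hf⟩ := hZ 1 one_pos (LinearMap.range (T : F →ₗ[𝕜] Z)) inferInstance
  have : FiniteDimensional 𝕜 B := f.toLinearEquiv.finiteDimensional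
  refine ((hK B this).of_equiv f (hf.le.trans_eq (by norm_num))).of_equiv e ?_
  gcongr
  · exact (ContinuousLinearMap.opNorm_le_bound _ (by norm_num) fun x => T.le_of_opNorm_le hT x)
  · refine ContinuousLinearMap.opNorm_le_bound _ (by norm_num) fun y => ?_
    obtain ⟨x, rfl⟩ := e.surjective y
    simpa [he] using hT' x

/-! ### Passage to the ultrapower -/

/-- Gluing embeddings of a cofinal family of subspaces along an ultrafilter. -/
theorem exists_ultrapower_embedding {𝕜 : Type k} [RCLike 𝕜] {I : Type u} (D : Ultrafilter I)
    {E : Type w} [NormedAddCommGroup E] [NormedSpace 𝕜 E]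
    {Y : Type v} [NormedAddCommGroup Y] [NormedSpace 𝕜 Y]
    (F : I → Submodule 𝕜 E) (hF : ∀ z, ∀ᶠ i in (D : Filter I), z ∈ F i)
    (v : ∀ i, F i →L[𝕜] Y) (hv : ∀ i, ‖v i‖ ≤ 1) :
    ∃ J : E →L[𝕜] Ultrapower 𝕜 Y D, ∀ z, ∃ y : lp (fun _ : I => Y) ∞,
      J z = (ultraNull 𝕜 (fun _ : I => Y) D).mkQ y ∧
        ∀ᶠ i in (D : Filter I), ∃ h : z ∈ F i, y i = v i ⟨z, h⟩ := by
  classical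
  -- The value 0 outside `F i` breaks linearity only on a `D`-null set of indices, which the
  -- quotient ignores.
  let y : E → I → Y := fun z i => if h : z ∈ F i then v i ⟨z, h⟩ else 0
  have hy : ∀ z i, ‖y z i‖ ≤ ‖z‖ := by
    intro z i
    by_cases h : z ∈ F i
    · simpa [y, h] using (v i).le_of_opNorm_le (hv i) ⟨z, h⟩
    · simp [y, h]
  have hmem : ∀ z, Memℓp (y z) ∞ := fun z => memℓp_infty ⟨‖z‖, by rintro _ ⟨i, rfl⟩; exact hy z i⟩
  let y' : E → lp (fun _ : I => Y) ∞ := fun z => ⟨y z, hmem z⟩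
  have hy' : ∀ z i, y' z i = y z i := fun _ _ => rfl
  have hmk : ∀ a b : lp (fun _ : I => Y) ∞, (∀ᶠ i in (D : Filter I), a i = b i) →
      (ultraNull 𝕜 (fun _ : I => Y) D).mkQ a = (ultraNull 𝕜 (fun _ : I => Y) D).mkQ b := by
    intro a b h
    refine (Submodule.Quotient.eq _).2 ?_
    change Tendsto (fun i => ‖(a - b) i‖) (D : Filter I) (𝓝 0)
    refine tendsto_const_nhds.congr' ?_
    filter_upwards [h] with i hi
    simp [hi]
  let J : E →ₗ[𝕜] Ultrapower 𝕜 Y D :=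
    { toFun := fun z => (ultraNull 𝕜 (fun _ : I => Y) D).mkQ (y' z)
      map_add' := by
        intro z w
        rw [← map_add]
        refine hmk _ _ ?_
        filter_upwards [hF z, hF w] with i hz hw
        have hzw : z + w ∈ F i := add_mem hz hw
        simp only [hy', lp.coeFn_add, Pi.add_apply, y, hz, hw, hzw, dite_true, ← map_add]
        rfl
      map_smul' := by
        intro c z
        rw [RingHom.id_apply, ← map_smul]
        refine hmk _ _ ?_
        filter_upwards [hF z] with i hz
        have hcz : c • z ∈ F i := Submodule.smul_mem _ c hz
        simp only [hy', lp.coeFn_smul, Pi.smul_apply, y, hz, hcz, dite_true, ← map_smul]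
        rfl }
  refine ⟨J.mkContinuous 1 fun z => ?_, fun z => ⟨y' z, rfl, ?_⟩⟩
  · rw [one_mul]
    refine (Submodule.Quotient.norm_mk_le _ (y' z)).trans ?_
    exact lp.norm_le_of_forall_le (norm_nonneg _) (hy z)
  · filter_upwards [hF z] with i hz
    exact ⟨hz, by simp [hy', y, hz]⟩

/-- The weak-star limit along `D` of a bounded family of operators into a dual space, as an
operator on the ultrapower. -/
theorem exists_weakStar_limit {𝕜 : Type k} [RCLike 𝕜] {I : Type u} (D : Ultrafilter I)
    {E : Type w} [NormedAddCommGroup E] [NormedSpace 𝕜 E]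
    {Y : Type v} [NormedAddCommGroup Y] [NormedSpace 𝕜 Y]
    (q : I → Y →L[𝕜] StrongDual 𝕜 E) {K : ℝ} (hK : 0 ≤ K) (hq : ∀ i, ‖q i‖ ≤ K) :
    ∃ Q : Ultrapower 𝕜 Y D →L[𝕜] StrongDual 𝕜 E, ∀ (y : lp (fun _ : I => Y) ∞) (f : E),
      Tendsto (fun i => q i (y i) f) (D : Filter I)
        (𝓝 (Q ((ultraNull 𝕜 (fun _ : I => Y) D).mkQ y) f)) := by
  have hbound : ∀ (i : I) (y : Y) (f : E), ‖q i y f‖ ≤ K * ‖y‖ * ‖f‖ := fun i y f =>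
    ((q i y).le_opNorm f).trans (by gcongr; exact (q i).le_of_opNorm_le (hq i) y)
  -- Bounded scalars converge along an ultrafilter; uniqueness of limits then gives bilinearity.
  have hex : ∀ (y : lp (fun _ : I => Y) ∞) (f : E), ∃ l : 𝕜, ‖l‖ ≤ K * ‖y‖ * ‖f‖ ∧
      Tendsto (fun i => q i (y i) f) (D : Filter I) (𝓝 l) := by
    intro y f
    have hc : IsCompact (Metric.closedBall (0 : 𝕜) (K * ‖y‖ * ‖f‖)) := isCompact_closedBall _ _
    obtain ⟨l, hl, hlim⟩ := hc.ultrafilter_le_nhds (D.map fun i => q i (y i) f) (by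
      refine tendsto_principal (f := fun i => q i (y i) f).2 (Eventually.of_forall fun i => ?_)
      refine mem_closedBall_zero_iff.2 ((hbound i _ f).trans ?_)
      gcongr
      exact lp.norm_apply_le_norm ENNReal.top_ne_zero y i)
    exact ⟨l, mem_closedBall_zero_iff.1 hl, hlim⟩
  choose L hL hlim using hex
  let Q₀ : lp (fun _ : I => Y) ∞ →L[𝕜] StrongDual 𝕜 E :=
    (LinearMap.mk₂ 𝕜 L
      (fun y y' f => tendsto_nhds_unique (hlim _ f)
        (by simpa using (hlim y f).add (hlim y' f)))
      (fun c y f => tendsto_nhds_unique (hlim _ f)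
        (by simpa using (hlim y f).const_mul c))
      (fun y f f' => tendsto_nhds_unique (hlim y _)
        (by simpa using (hlim y f).add (hlim y f')))
      (fun c y f => tendsto_nhds_unique (hlim y _)
        (by simpa using (hlim y f).const_mul c))).mkContinuous₂ K hL
  refine ⟨(ultraNull 𝕜 (fun _ : I => Y) D).liftQL Q₀ fun y hy => ?_, hlim⟩
  have hy' : Tendsto (fun i => ‖y i‖) (D : Filter I) (𝓝 0) := hy
  refine ContinuousLinearMap.ext fun f => tendsto_nhds_unique (hlim y f) ?_
  refine squeeze_zero_norm (fun i => hbound i (y i) f) ?_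
  simpa using (hy'.const_mul K).mul_const ‖f‖

/-- A space that is a retract of `M` is isomorphic to a complemented subspace of `M`. -/
theorem exists_closedComplemented_equiv {𝕜 : Type*} [RCLike 𝕜] {E M : Type*}
    [NormedAddCommGroup E] [NormedSpace 𝕜 E] [SeminormedAddCommGroup M] [NormedSpace 𝕜 M]
    (J : E →L[𝕜] M) (Q : M →L[𝕜] E) (h : ∀ x, Q (J x) = x) :
    ∃ R : Submodule 𝕜 M, R.ClosedComplemented ∧ Nonempty (E ≃L[𝕜] R) := by
  let R := LinearMap.range (J : E →ₗ[𝕜] M)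
  let J' : E →L[𝕜] R := J.codRestrict R fun x => ⟨x, rfl⟩
  have hJ' : ∀ y : R, J' (Q y) = y := by
    rintro ⟨_, x, rfl⟩
    exact Subtype.ext (congrArg J (h x))
  exact ⟨R, ⟨J'.comp Q, hJ'⟩,
    ⟨ContinuousLinearEquiv.equivOfInverse J' (Q.comp R.subtypeL) h hJ'⟩⟩

theorem exists_ultrapower_complemented_bidual {𝕜 : Type k} [RCLike 𝕜]
    {Y : Type v} [NormedAddCommGroup Y] [NormedSpace 𝕜 Y]
    {W : Type w} [NormedAddCommGroup W] [NormedSpace 𝕜 W]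
    {Z : Type u} [NormedAddCommGroup Z] [NormedSpace 𝕜 Z]
    (hY : FiniteProjectionProperty 𝕜 Y W) (hZ : FinitelyRepresentable 𝕜 Z W) :
    ∃ (I : Type (max u k)) (D : Ultrafilter I) (E : Submodule 𝕜 (Ultrapower 𝕜 Y D)),
      E.ClosedComplemented ∧ Nonempty (StrongDual 𝕜 (StrongDual 𝕜 Z) ≃L[𝕜] E) := by
  classical
  obtain ⟨K, hK⟩ := hY.exists_bidual_factorization hZ
  let F : Finset (StrongDual 𝕜 (StrongDual 𝕜 Z)) → Submodule 𝕜 (StrongDual 𝕜 (StrongDual 𝕜 Z)) :=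
    fun s => Submodule.span 𝕜 s
  choose v q hqv hv hq using fun s => hK (F s) (FiniteDimensional.span_finset 𝕜 s)
  -- Refining `atTop` makes each `z` lie in the span of `s` for `D`-almost all `s`.
  let D : Ultrafilter (Finset (StrongDual 𝕜 (StrongDual 𝕜 Z))) := Ultrafilter.of atTop
  have hF : ∀ z, ∀ᶠ s in (D : Filter (Finset (StrongDual 𝕜 (StrongDual 𝕜 Z)))), z ∈ F s := by
    intro z
    refine Ultrafilter.of_le atTop ?_
    filter_upwards [eventually_ge_atTop {z}] with s hs
    exact Submodule.subset_span (Finset.singleton_subset_iff.1 hs)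
  obtain ⟨J, hJ⟩ := exists_ultrapower_embedding D F hF v hv
  obtain ⟨Q, hQ⟩ := exists_weakStar_limit D (fun s => (F s).subtypeL.comp (q s))
    ((norm_nonneg (q ∅)).trans (hq ∅)) fun s => (ContinuousLinearMap.opNorm_comp_le _ _).trans
      ((mul_le_of_le_one_left (norm_nonneg _) (Submodule.norm_subtypeL_le _)).trans (hq s))
  refine ⟨_, D, exists_closedComplemented_equiv J Q fun z => ?_⟩
  obtain ⟨y, hJy, hy⟩ := hJ z
  ext f
  rw [hJy]
  refine tendsto_nhds_unique (hQ y f) (tendsto_const_nhds.congr' ?_)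
  filter_upwards [hy] with s ⟨hz, hys⟩
  simp [hys, hqv]

end

theorem theorem9 {𝕜 : Type k} [RCLike 𝕜]
    {X : Type u} [NormedAddCommGroup X] [NormedSpace 𝕜 X] [CompleteSpace X]
    {Y : Type v} [NormedAddCommGroup Y] [NormedSpace 𝕜 Y] [CompleteSpace Y]
    {W : Type w} [NormedAddCommGroup W] [NormedSpace 𝕜 W] [CompleteSpace W]
    (hY : FiniteProjectionProperty 𝕜 Y W) (hX : CrudelyFinitelyRepresentable 𝕜 X W) :
    ∃ (I : Type (max u k)) (D : Ultrafilter I) (E : Submodule 𝕜 (Ultrapower 𝕜 Y D)),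
      E.ClosedComplemented ∧ Nonempty (StrongDual 𝕜 (StrongDual 𝕜 X) ≃L[𝕜] E) := by
  obtain ⟨Z, _, _, _, ⟨e⟩, hZ⟩ := hX
  obtain ⟨I, D, E, hE, ⟨T⟩⟩ := exists_ultrapower_complemented_bidual hY hZ
  let e' : StrongDual 𝕜 X ≃L[𝕜] StrongDual 𝕜 Z := e.arrowCongr (ContinuousLinearEquiv.refl 𝕜 𝕜)
  let e'' : StrongDual 𝕜 (StrongDual 𝕜 X) ≃L[𝕜] StrongDual 𝕜 (StrongDual 𝕜 Z) :=
    e'.arrowCongr (ContinuousLinearEquiv.refl 𝕜 𝕜)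
  exact ⟨I, D, E, hE, ⟨e''.trans T⟩⟩
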